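/- Let $m,n\ge 1$, let $\|\cdot\|_\alpha$ be a norm on $\mathbb R^m$ and $\|\cdot\|_\beta$ a norm on $\mathbb R^n$, and let $\|y\|_{\beta^*}=\max_{x\ne 0}\langle x,y\rangle/\|x\|_\beta$ be the dual norm of $\|\cdot\|_\beta$. Assume that $\|\cdot\|_\alpha$ and $\|\cdot\|_{\beta^*}$ are Fréchet differentiable at every nonzero vector, and that both are strongly monotonic (a norm is strongly monotonic if $|x|\le|y|$ and $|x|\neq|y|$, entrywise, imply $\|x\|<\|y\|$). For $\gamma\in\{\alpha,\beta^*\}$ let $J_\gamma(x)=\nabla\|x\|_\gamma$ for $x\neq0$ and $J_\gamma(0)=0$. Let $A\in\mathbb R^{m\times n}$ have nonnegative entries and suppose that $A^TA$ is irreducible (the $1\times1$ zero matrix is not counted as irreducible). Put $$f_A(x)=\frac{\|Ax\|_\alpha}{\|x\|_\beta}\ (x\ne0),\qquad \|A\|_{\beta\to\alpha}=\max_{x\neq0}f_A(x),\qquad \mathcal S_A(x)=J_{\beta^*}(A^TJ_\alpha(Ax)).$$ A vector $x\ne0$ is a critical point of $f_A$ if $0\in\partial f_A(x)$, where $\partial$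 is Clarke's generalized gradient; since $f_A(cx)=f_A(x)$ for $c>0$, critical points are considered up to positive scaling. For $x,y\in\mathbb R^n_+$ write $x\sim y$ if $cy\le x\le Cy$ for some $c,C>0$, let $M(x/y)=\inf\{C>0: x\le Cy\}$, and let Hilbert's projective metric be $d_H(x,y)=\ln(M(x/y)M(y/x))$ if $x\sim y$ are nonzero, $d_H(0,0)=0$, and $d_H(x,y)=\infty$ otherwise. The Birkhoff contraction ratio of a map $F$ on $\mathbb R^n_+$ is $$\kappa_H(F)=\inf\{C>0:\ d_H(F(x),F(y))\le C\,d_H(x,y)\ \text{ for all } x,y\in\mathbb R^n_+ \text{ with } x\sim y\}\in[0,\infty].$$ Suppose that $\kappa_H(\mathcal S_A)\le\tau<1$, where $\tau\ge 0$. Then: 1. Up to positive scaling, $f_A$ has a unique critical point in $\mathbb R^n_+\setminus\{0\}$: there is exactly one critical point $x^+\in\mathbb R^n_+$ with $\|x^+\|_\beta=1$, and every critical point $y\in\mathbb R^n_+\setminus\{0\}$ is $y=\|y\|_\beta\,x^+$. Moreover $x^+$ is positive and $f_A(x^+)=\|A\|_{\beta\to\alpha}$. 2. Let $x_0$ be a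 positive vector, normalized so that $\|x_0\|_\beta=1$ (that is, any positive starting vector is first divided by its $\beta$-norm), and let $x_{k+1}=\mathcal S_A(x_k)$. Then $d_H(x_0,x_1)<\infty$ and, for all $k\ge0$, $$\|x_k-x^+\|_\infty\le\tau^kC,\qquad C=\max_{i=1,\dots,n}\frac{d_H(x_0,x_1)}{(1-\tau)\|e_i\|_\beta},$$ where $e_1,\dots,e_n$ is the canonical basis of $\mathbb R^n$, and $$(1-\tau^k\tilde C)\,\|A\|_{\beta\to\alpha}\le\|Ax_k\|_\alpha\le\|A\|_{\beta\to\alpha},\qquad \tilde C=C\max_{x\in\mathbb R^n,\ x\neq0}\frac{\|x\|_\beta}{\|x\|_\infty}.$$ In particular $x_k\to x^+$ as $k\to\infty$. -/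

import Mathlib

open Filter Topology
open scoped NNReal ENNReal Matrix

noncomputable section

/-! A vector norm on `ℝⁿ` is a `Seminorm ℝ (Fin n → ℝ)` that vanishes only at `0`.  The topology of
`Fin n → ℝ` is the usual one and its built-in norm `‖x‖` is the infinity norm. -/

/-- The dual norm `‖y‖_* = max_{x ≠ 0} ⟨x, y⟩ / ‖x‖`. -/
def dualNorm {n : ℕ} (N : (Fin n → ℝ) → ℝ) (y : Fin n → ℝ) : ℝ :=
  ⨆ x : {x : Fin n → ℝ // x ≠ 0}, (x.1 ⬝ᵥ y) / N x.1

/-- Strong monotonicity: `|x| ≤ |y|` and `|x| ≠ |y|` (entrywise) imply `‖x‖ < ‖y‖`. -/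
def StronglyMonotonic {n : ℕ} (N : (Fin n → ℝ) → ℝ) : Prop :=
  ∀ x y : Fin n → ℝ, |x| ≤ |y| → |x| ≠ |y| → N x < N y

/-- Fréchet differentiability of a norm, i.e. at every nonzero point. -/
def NormDifferentiable {n : ℕ} (N : (Fin n → ℝ) → ℝ) : Prop :=
  ∀ x : Fin n → ℝ, x ≠ 0 → DifferentiableAt ℝ N x

open Classical in
/-- `J_N`: the gradient of `N` at `x ≠ 0`, and `J_N 0 = 0`. -/
def normGradient {n : ℕ} (N : (Fin n → ℝ) → ℝ) (x : Fin n → ℝ) : Fin n → ℝ :=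
  if x = 0 then 0 else fun i => fderiv ℝ N x (Pi.single i 1)

/-- The subdifferential of a convex function. -/
def subdifferential {n : ℕ} (N : (Fin n → ℝ) → ℝ) (x : Fin n → ℝ) : Set (Fin n → ℝ) :=
  {y | ∀ z, N x + y ⬝ᵥ (z - x) ≤ N z}

theorem fderiv_eq_normGradient_dotProduct {n : ℕ} (N : (Fin n → ℝ) → ℝ) {x : Fin n → ℝ}
    (hx : x ≠ 0) (v : Fin n → ℝ) : fderiv ℝ N x v = normGradient N x ⬝ᵥ v := by
  have h : v = ∑ i, v i • (Pi.single i (1 : ℝ) : Fin n → ℝ) := by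
    ext j; simp [Finset.sum_apply, Pi.single_apply]
  conv_lhs => rw [h, map_sum]
  simp [normGradient, hx, dotProduct, mul_comm]

/-- At a nonzero point of differentiability of a norm, its subdifferential is the singleton
consisting of its gradient, so `J_N` is the (single-valued) subdifferential of the norm. -/
theorem subdifferential_eq_singleton {n : ℕ} (N : Seminorm ℝ (Fin n → ℝ)) {x : Fin n → ℝ}
    (hx : x ≠ 0) (hd : DifferentiableAt ℝ N x) :
    subdifferential N x = {normGradient N x} := by
  ext y
  simp only [subdifferential, Set.mem_ofPred_eq, Set.mem_singleton_iff]
  constructor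
  · intro h
    let L : (Fin n → ℝ) →L[ℝ] ℝ :=
      LinearMap.toContinuousLinearMap
        { toFun := fun z => y ⬝ᵥ z
          map_add' := fun a b => dotProduct_add y a b
          map_smul' := fun c a => by simp }
    have hL : ∀ z, L z = y ⬝ᵥ z := fun z => rfl
    have hmin : IsLocalMin (fun z => N z - L z) x := by
      refine Filter.Eventually.of_forall fun z => ?_
      have := h z
      rw [dotProduct_sub] at this
      simp only [hL]
      linarith
    have h0 := hmin.hasFDerivAt_eq_zero (hd.hasFDerivAt.sub L.hasFDerivAt)
    ext i
    have h1 := congrArg (fun T : (Fin n → ℝ) →L[ℝ] ℝ => T (Pi.single i 1)) h0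
    simp only [sub_apply, zero_apply, hL] at h1
    simp only [normGradient, hx, if_false]
    simp at h1
    linarith
  · rintro rfl z
    rw [← fderiv_eq_normGradient_dotProduct (N := N) hx]
    have hl := (hd.hasFDerivAt.hasLineDerivAt (z - x)).tendsto_slope_zero_right
    have hle : fderiv ℝ N x (z - x) ≤ N z - N x := by
      refine le_of_tendsto hl ?_
      filter_upwards [Ioo_mem_nhdsGT (zero_lt_one (α := ℝ))] with t ht
      have hc : N (x + t • (z - x)) ≤ (1 - t) * N x + t * N z := by
        have e : x + t • (z - x) = (1 - t) • x + t • z := by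
          rw [smul_sub, sub_smul, one_smul]; abel
        rw [e]
        refine (map_add_le_add N _ _).trans ?_
        rw [map_smul_eq_mul, map_smul_eq_mul, Real.norm_of_nonneg (by linarith [ht.2]),
          Real.norm_of_nonneg ht.1.le]
      rw [smul_eq_mul, inv_mul_le_iff₀ ht.1]
      linarith
    linarith

/-- `f_A x = ‖A x‖_α / ‖x‖_β`. -/
def normRatio {m n : ℕ} (α : (Fin m → ℝ) → ℝ) (β : (Fin n → ℝ) → ℝ)
    (A : Matrix (Fin m) (Fin n) ℝ) (x : Fin n → ℝ) : ℝ :=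
  α (A *ᵥ x) / β x

/-- `‖A‖_{β → α} = max_{x ≠ 0} ‖A x‖_α / ‖x‖_β`. -/
def mixedNorm {m n : ℕ} (α : (Fin m → ℝ) → ℝ) (β : (Fin n → ℝ) → ℝ)
    (A : Matrix (Fin m) (Fin n) ℝ) : ℝ :=
  ⨆ x : {x : Fin n → ℝ // x ≠ 0}, normRatio α β A x.1

/-- The power iterator `S_A x = J_{β*}(Aᵀ J_α(A x))`. -/
def powerMap {m n : ℕ} (α : (Fin m → ℝ) → ℝ) (β : (Fin n → ℝ) → ℝ)
    (A : Matrix (Fin m) (Fin n) ℝ) (x : Fin n → ℝ) : Fin n → ℝ :=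
  normGradient (dualNorm β) (Aᵀ *ᵥ normGradient α (A *ᵥ x))

/-- The power sequence `x₀ / ‖x₀‖_β`, `x_{k+1} = S_A(x_k)`. -/
def powerSeq {m n : ℕ} (α : (Fin m → ℝ) → ℝ) (β : (Fin n → ℝ) → ℝ)
    (A : Matrix (Fin m) (Fin n) ℝ) (x₀ : Fin n → ℝ) : ℕ → Fin n → ℝ
  | 0 => (β x₀)⁻¹ • x₀
  | k + 1 => powerMap α β A (powerSeq α β A x₀ k)

/-- The Clarke directional derivative
`f°(x; v) = limsup_{y → x, t ↓ 0} (f (y + t v) - f y) / t`. -/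
def clarkeDeriv {n : ℕ} (f : (Fin n → ℝ) → ℝ) (x v : Fin n → ℝ) : EReal :=
  limsup (fun p : (Fin n → ℝ) × ℝ => (((f (p.1 + p.2 • v) - f p.1) / p.2 : ℝ) : EReal))
    (𝓝 x ×ˢ 𝓝[>] (0 : ℝ))

/-- Clarke's generalized gradient `∂f(x)`. -/
def clarkeGradient {n : ℕ} (f : (Fin n → ℝ) → ℝ) (x : Fin n → ℝ) : Set (Fin n → ℝ) :=
  {ξ | ∀ v, ((ξ ⬝ᵥ v : ℝ) : EReal) ≤ clarkeDeriv f x v}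

/-- Critical points of `f_A`: nonzero vectors `x` with `0 ∈ ∂f_A(x)`. -/
def IsCriticalPoint {m n : ℕ} (α : (Fin m → ℝ) → ℝ) (β : (Fin n → ℝ) → ℝ)
    (A : Matrix (Fin m) (Fin n) ℝ) (x : Fin n → ℝ) : Prop :=
  x ≠ 0 ∧ 0 ∈ clarkeGradient (normRatio α β A) x

/-- Comparability in the nonnegative orthant: `c y ≤ x ≤ C y` for some `c, C > 0`. -/
def ConeComparable {n : ℕ} (x y : Fin n → ℝ) : Prop :=
  ∃ c C : ℝ, 0 < c ∧ 0 < C ∧ c • y ≤ x ∧ x ≤ C • y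

/-- `M(x / y) = inf {C > 0 | x ≤ C y}`. -/
def coneSup {n : ℕ} (x y : Fin n → ℝ) : ℝ :=
  sInf {C : ℝ | 0 < C ∧ x ≤ C • y}

open Classical in
/-- Hilbert's projective metric on the nonnegative orthant, with values in `[0, ∞]`. -/
def hilbertDist {n : ℕ} (x y : Fin n → ℝ) : ℝ≥0∞ :=
  if x = 0 ∧ y = 0 then 0
  else if ConeComparable x y then ENNReal.ofReal (Real.log (coneSup x y * coneSup y x))
  else ⊤

/-- The Birkhoff contraction ratio `κ_H(F) ∈ [0, ∞]`: the smallest Lipschitz constant of `F` on the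
nonnegative orthant with respect to Hilbert's metric. -/
def birkhoffRatio {n m : ℕ} (F : (Fin n → ℝ) → (Fin m → ℝ)) : ℝ≥0∞ :=
  sInf {c : ℝ≥0∞ | ∃ C : ℝ≥0, 0 < C ∧ c = C ∧
    ∀ x y : Fin n → ℝ, 0 ≤ x → 0 ≤ y → ConeComparable x y →
      hilbertDist (F x) (F y) ≤ C * hilbertDist x y}

/-- The constant `C = max_i d_H(x₀, x₁) / ((1 - τ) ‖e_i‖_β)` for the power sequence. -/
def rateConst {m n : ℕ} (α : (Fin m → ℝ) → ℝ) (β : (Fin n → ℝ) → ℝ)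
    (A : Matrix (Fin m) (Fin n) ℝ) (τ : ℝ) (x₀ : Fin n → ℝ) : ℝ :=
  ⨆ i : Fin n, (hilbertDist (powerSeq α β A x₀ 0) (powerSeq α β A x₀ 1)).toReal /
    ((1 - τ) * β (Pi.single i 1))

/-- `max_{x ≠ 0} ‖x‖_β / ‖x‖_∞`. -/
def supNormRatio {n : ℕ} (β : (Fin n → ℝ) → ℝ) : ℝ :=
  ⨆ x : {x : Fin n → ℝ // x ≠ 0}, β x.1 / ‖x.1‖

end

/-!
Hilbert's metric turns the power iterator `S_A` into a contraction, so everything reduces to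
identifying nonnegative critical points of `f_A` with fixed points of `S_A`, and to passing between
Hilbert's metric and the infinity norm.

A unit vector `x` with `A x ≠ 0` is fixed by `S_A` as soon as `⟨Aᵀ J_α(A x), z⟩ ≤ ‖A x‖_α ‖z‖_β`
for all `z` (`powerMap_eq_self`): with `w = Aᵀ J_α(A x)` this says `‖w‖_{β*} ≤ ‖A x‖_α = ⟨x, w⟩`,
so `x` is a subgradient of the differentiable norm `‖·‖_{β*}` at `w`, that is, its gradient there.
The inequality holds at a maximizer of `f_A` since `J_α(A x)` is in the dual unit ball, and a
nonnegative maximizer exists by compactness (`exists_nonneg_maximizer`); here `‖·‖_β` depends only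
on absolute values because its dual norm does. It holds at a nonnegative Clarke critical point as
well (`criticalPoint_fderiv_le`): convexity bounds the difference quotients of `f_A` near the
point by quotients with a fixed step `s`, which depend continuously on the base point, so that the
Clarke derivative is controlled without any regularity of `‖·‖_β`; then `s → 0`.

A nonnegative nonzero fixed point is positive, since gradients of strongly monotonic norms are
positive wherever the argument is, which makes the zero set of the fixed point closed under the
graph of the irreducible matrix `Aᵀ A` (`pos_of_powerMap_eq_self`). Among positive unit vectors,
Hilbert's metric is finite and satisfies `|x i - y i| ≤ d_H(x, y) / ‖e_i‖_β`
(`abs_sub_le_hilbertDist_div`). Uniqueness and the error estimates then follow as in Banach's fixed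
point theorem.
-/

/-! ### Norms on `ℝⁿ` and their duals -/

theorem Seminorm.continuous_of_pi {n : ℕ} (N : Seminorm ℝ (Fin n → ℝ)) : Continuous N :=
  continuousOn_univ.1 (N.convexOn.continuousOn isOpen_univ)

theorem Seminorm.pos_of_ne_zero {n : ℕ} {N : Seminorm ℝ (Fin n → ℝ)} (hN : ∀ x, N x = 0 → x = 0)
    {x : Fin n → ℝ} (hx : x ≠ 0) : 0 < N x :=
  lt_of_le_of_ne (apply_nonneg N x) fun h => hx (hN x h.symm)

theorem Seminorm.exists_pos_mul_norm_le {n : ℕ} {N : Seminorm ℝ (Fin n → ℝ)}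
    (hN : ∀ x, N x = 0 → x = 0) : ∃ c, 0 < c ∧ ∀ x, c * ‖x‖ ≤ N x := by
  rcases (Metric.sphere (0 : Fin n → ℝ) 1).eq_empty_or_nonempty with he | hne
  · refine ⟨1, one_pos, fun x => ?_⟩
    by_cases hx : x = 0
    · simp [hx]
    · have : ‖x‖⁻¹ • x ∈ Metric.sphere (0 : Fin n → ℝ) 1 := by
        simp [norm_smul, hx]
      simp [he] at this
  · obtain ⟨u, hu, hmin⟩ := (isCompact_sphere (0 : Fin n → ℝ) 1).exists_isMinOn hne
      N.continuous_of_pi.continuousOn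
    have hu0 : u ≠ 0 := by rintro rfl; simp at hu
    refine ⟨N u, N.pos_of_ne_zero hN hu0, fun x => ?_⟩
    by_cases hx : x = 0
    · simp [hx]
    · have hx' : 0 < ‖x‖ := norm_pos_iff.2 hx
      have h : N u ≤ N (‖x‖⁻¹ • x) := hmin (by simp [norm_smul, hx])
      rw [map_smul_eq_mul, norm_inv, norm_norm, inv_mul_eq_div, le_div_iff₀ hx'] at h
      exact h

theorem dotProduct_le_sum_mul_norm {n : ℕ} (x y : Fin n → ℝ) : x ⬝ᵥ y ≤ (∑ i, |y i|) * ‖x‖ := by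
  rw [dotProduct, Finset.sum_mul]
  refine Finset.sum_le_sum fun i _ => ?_
  calc x i * y i ≤ |x i * y i| := le_abs_self _
    _ = |y i| * |x i| := by rw [abs_mul, mul_comm]
    _ ≤ |y i| * ‖x‖ := mul_le_mul_of_nonneg_left (norm_le_pi_norm x i) (abs_nonneg _)

section Dual

variable {n : ℕ} {N : Seminorm ℝ (Fin n → ℝ)}

theorem bddAbove_dualNorm (hN : ∀ x, N x = 0 → x = 0) (y : Fin n → ℝ) :
    BddAbove (Set.range fun x : {x : Fin n → ℝ // x ≠ 0} => (x.1 ⬝ᵥ y) / N x.1) := by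
  obtain ⟨c, hc, h⟩ := N.exists_pos_mul_norm_le hN
  refine ⟨(∑ i, |y i|) / c, ?_⟩
  rintro _ ⟨⟨x, hx⟩, rfl⟩
  have hs : 0 ≤ ∑ i, |y i| := Finset.sum_nonneg fun i _ => abs_nonneg _
  rw [div_le_iff₀ (N.pos_of_ne_zero hN hx), div_mul_eq_mul_div, le_div_iff₀ hc]
  calc x ⬝ᵥ y * c ≤ (∑ i, |y i|) * ‖x‖ * c :=
        mul_le_mul_of_nonneg_right (dotProduct_le_sum_mul_norm x y) hc.le
    _ = (∑ i, |y i|) * (c * ‖x‖) := by ring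
    _ ≤ (∑ i, |y i|) * N x := mul_le_mul_of_nonneg_left (h x) hs

theorem dotProduct_le_mul_dualNorm (hN : ∀ x, N x = 0 → x = 0) (x y : Fin n → ℝ) :
    x ⬝ᵥ y ≤ N x * dualNorm N y := by
  by_cases hx : x = 0
  · simp [hx]
  · have h := le_ciSup (bddAbove_dualNorm hN y) ⟨x, hx⟩
    rw [div_le_iff₀ (N.pos_of_ne_zero hN hx), mul_comm] at h
    exact h

theorem dualNorm_le (hn : 0 < n) (hN : ∀ x, N x = 0 → x = 0) {y : Fin n → ℝ} {c : ℝ}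
    (h : ∀ x, x ⬝ᵥ y ≤ c * N x) : dualNorm N y ≤ c := by
  have : Nonempty {x : Fin n → ℝ // x ≠ 0} :=
    ⟨Pi.single ⟨0, hn⟩ 1, by simp⟩
  refine ciSup_le fun x => ?_
  rw [div_le_iff₀ (N.pos_of_ne_zero hN x.2)]
  exact h x.1

/-- Hahn–Banach: a functional in the dual unit ball attains the norm at `x`. -/
theorem exists_dualNorm_le_one (hn : 0 < n) (hN : ∀ x, N x = 0 → x = 0) (x : Fin n → ℝ) :
    ∃ z, dualNorm N z ≤ 1 ∧ x ⬝ᵥ z = N x := by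
  by_cases hx : x = 0
  · refine ⟨0, dualNorm_le hn hN fun y => ?_, by simp [hx]⟩
    simp
  · obtain ⟨g, hg, hgle⟩ := exists_extension_of_le_sublinear
      (LinearPMap.mkSpanSingleton x (N x) hx) N
      (fun c hc y => by rw [map_smul_eq_mul, Real.norm_of_nonneg hc.le]) (map_add_le_add N) (by
        rintro ⟨y, hy⟩
        obtain ⟨c, rfl⟩ := Submodule.mem_span_singleton.1 hy
        have h : LinearPMap.mkSpanSingleton x (N x) hx ⟨c • x, hy⟩ = c • N x :=
          LinearPMap.mkSpanSingleton'_apply _ _ _ _ _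
        rw [h, smul_eq_mul, map_smul_eq_mul]
        exact mul_le_mul_of_nonneg_right (Real.le_norm_self c) (apply_nonneg N x))
    have hgz : ∀ y, y ⬝ᵥ (fun i => g (Pi.single i 1)) = g y := fun y => by
      rw [LinearMap.pi_apply_eq_sum_univ g y]
      simp only [dotProduct, smul_eq_mul]
      refine Finset.sum_congr rfl fun i _ => ?_
      congr 2
      ext j
      simp [Pi.single_apply, eq_comm]
    refine ⟨fun i => g (Pi.single i 1), dualNorm_le hn hN fun y => ?_, ?_⟩
    · rw [hgz, one_mul]
      exact hgle y
    · rw [hgz]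
      exact (hg ⟨x, Submodule.mem_span_singleton_self x⟩).trans
        (LinearPMap.mkSpanSingleton_apply ℝ ℝ hx (N x))

/-- The bidual of a norm dominates the norm, stated for unit balls. -/
theorem le_one_of_dotProduct_le_dualNorm (hn : 0 < n) (hN : ∀ x, N x = 0 → x = 0)
    {x : Fin n → ℝ} (h : ∀ z, x ⬝ᵥ z ≤ dualNorm N z) : N x ≤ 1 := by
  obtain ⟨z, hz, hxz⟩ := exists_dualNorm_le_one hn hN x
  rw [← hxz]
  exact (h z).trans hz

/-- The dual of a norm on `ℝⁿ` as a `Seminorm`, so that the facts about gradients of norms apply to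
it. The assumption `0 < n` makes the supremum defining the dual norm one over a nonempty set. -/
noncomputable def dualSeminorm (hn : 0 < n) (N : Seminorm ℝ (Fin n → ℝ))
    (hN : ∀ x, N x = 0 → x = 0) :
    Seminorm ℝ (Fin n → ℝ) :=
  Seminorm.ofSMulLE (dualNorm N) (by simp [dualNorm])
    (fun x y => dualNorm_le hn hN fun z => by
      rw [dotProduct_add, add_mul, mul_comm _ (N z), mul_comm _ (N z)]
      exact add_le_add (dotProduct_le_mul_dualNorm hN z x) (dotProduct_le_mul_dualNorm hN z y))
    (fun r x => dualNorm_le hn hN fun z => by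
      have h := dotProduct_le_mul_dualNorm hN (r • z) x
      rw [map_smul_eq_mul, smul_dotProduct] at h
      rw [dotProduct_smul]
      linarith)

@[simp]
theorem coe_dualSeminorm (hn : 0 < n) (hN : ∀ x, N x = 0 → x = 0) :
    ⇑(dualSeminorm hn N hN) = dualNorm N :=
  rfl

end Dual

/-! ### Strongly monotonic norms -/

section Monotone

variable {n : ℕ}

theorem eq_zero_of_abs_eq_zero {x : Fin n → ℝ} (h : |x| = 0) : x = 0 :=
  funext fun i => abs_eq_zero.1 (congrFun h i)

theorem StronglyMonotonic.mono {N : Seminorm ℝ (Fin n → ℝ)} (h : StronglyMonotonic N)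
    {x y : Fin n → ℝ} (hxy : |x| ≤ |y|) : N x ≤ N y := by
  by_cases he : |x| = |y|
  · by_cases hy : y = 0
    · subst hy
      rw [abs_zero] at he
      rw [eq_zero_of_abs_eq_zero he]
    -- when `|x| = |y|`, compare `x` with the slightly larger vector `(1 + ε) y`
    · refine le_of_forall_pos_le_add fun ε hε => ?_
      have hle : N x ≤ (1 + ε / (N y + 1)) * N y := by
        have hp : 0 < N y + 1 := by linarith [apply_nonneg N y]
        have hd : 0 < ε / (N y + 1) := div_pos hε hp
        have h1 : |(1 + ε / (N y + 1)) • y| = |y| + (ε / (N y + 1)) • |y| := by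
          ext i
          simp only [Pi.abs_apply, Pi.smul_apply, Pi.add_apply, smul_eq_mul, abs_mul]
          rw [abs_of_pos (by linarith)]
          ring
        have h2 := (h x ((1 + ε / (N y + 1)) • y) ?_ ?_).le
        · rwa [map_smul_eq_mul, Real.norm_of_nonneg (by linarith)] at h2
        · rw [h1]
          exact hxy.trans (le_add_of_nonneg_right (smul_nonneg hd.le (abs_nonneg y)))
        · rw [h1, he]
          intro hc
          rw [left_eq_add, smul_eq_zero] at hc
          rcases hc with hc | hc
          · exact hd.ne' hc
          · exact hy (eq_zero_of_abs_eq_zero hc)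
      refine hle.trans ?_
      have hp : 0 < N y + 1 := by linarith [apply_nonneg N y]
      have : ε / (N y + 1) * N y ≤ ε := by
        rw [div_mul_eq_mul_div, div_le_iff₀ hp]
        nlinarith [apply_nonneg N y]
      linarith
  · exact (h x y hxy he).le

/-- A norm is monotonic as soon as its dual norm is strongly monotonic. -/
theorem mono_of_stronglyMonotonic_dualNorm (hn : 0 < n) {N : Seminorm ℝ (Fin n → ℝ)}
    (hN : ∀ x, N x = 0 → x = 0) (h : StronglyMonotonic (dualNorm N)) {x y : Fin n → ℝ}
    (hxy : |x| ≤ |y|) : N x ≤ N y := by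
  obtain ⟨z, hz, hxz⟩ := exists_dualNorm_le_one hn hN x
  -- `z'` has the absolute values of `z` and the signs of `y`
  let z' : Fin n → ℝ := fun i => if 0 ≤ y i then |z i| else -|z i|
  have hz' : dualNorm N z' ≤ dualNorm N z :=
    StronglyMonotonic.mono (N := dualSeminorm hn N hN) h (fun i => by
      simp only [z', Pi.abs_apply]
      split_ifs <;> simp)
  calc N x = x ⬝ᵥ z := hxz.symm
    _ ≤ y ⬝ᵥ z' := by
        refine Finset.sum_le_sum fun i _ => ?_
        have h1 : |x i| ≤ |y i| := hxy i
        have h2 : y i * z' i = |y i| * |z i| := by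
          simp only [z']
          split_ifs with hy
          · rw [abs_of_nonneg hy]
          · rw [abs_of_neg (not_le.1 hy)]; ring
        rw [h2]
        calc x i * z i ≤ |x i * z i| := le_abs_self _
          _ = |x i| * |z i| := abs_mul _ _
          _ ≤ |y i| * |z i| := mul_le_mul_of_nonneg_right h1 (abs_nonneg _)
    _ ≤ N y * dualNorm N z' := dotProduct_le_mul_dualNorm hN y z'
    _ ≤ N y * 1 := mul_le_mul_of_nonneg_left (hz'.trans hz) (apply_nonneg N y)
    _ = N y := mul_one _

end Monotone

/-! ### The gradient of a norm -/

section Gradient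

variable {n : ℕ} {N : Seminorm ℝ (Fin n → ℝ)}

theorem normGradient_dotProduct_sub_le (hd : NormDifferentiable N) {x : Fin n → ℝ} (hx : x ≠ 0)
    (z : Fin n → ℝ) : N x + normGradient N x ⬝ᵥ (z - x) ≤ N z := by
  have h : normGradient N x ∈ subdifferential N x := by
    rw [subdifferential_eq_singleton N hx (hd x hx)]
    rfl
  exact h z

/-- Euler's identity for the gradient of a norm. -/
theorem normGradient_dotProduct_self (hd : NormDifferentiable N) {x : Fin n → ℝ} (hx : x ≠ 0) :
    normGradient N x ⬝ᵥ x = N x := by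
  have h0 := normGradient_dotProduct_sub_le hd hx 0
  have h2 := normGradient_dotProduct_sub_le hd hx ((2 : ℝ) • x)
  rw [map_smul_eq_mul, Real.norm_of_nonneg zero_le_two,
    show (2 : ℝ) • x - x = x by rw [two_smul]; abel] at h2
  rw [zero_sub, dotProduct_neg, map_zero] at h0
  linarith

/-- The gradient of a norm lies in the dual unit ball. -/
theorem normGradient_dotProduct_le (hd : NormDifferentiable N) {x : Fin n → ℝ} (hx : x ≠ 0)
    (z : Fin n → ℝ) : normGradient N x ⬝ᵥ z ≤ N z := by
  have h := normGradient_dotProduct_sub_le hd hx z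
  rw [dotProduct_sub, normGradient_dotProduct_self hd hx] at h
  linarith

/-- The gradient of a norm at `x` is the only vector of the dual unit ball whose pairing with `x`
attains the norm of `x`. -/
theorem eq_normGradient (hd : NormDifferentiable N) {x : Fin n → ℝ} (hx : x ≠ 0) {ξ : Fin n → ℝ}
    (hle : ∀ z, ξ ⬝ᵥ z ≤ N z) (heq : ξ ⬝ᵥ x = N x) : ξ = normGradient N x := by
  have h : ξ ∈ subdifferential N x := fun z => by
    rw [dotProduct_sub, heq]
    linarith [hle z]
  rwa [subdifferential_eq_singleton N hx (hd x hx)] at h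

theorem normGradient_pos (hd : NormDifferentiable N) (hm : StronglyMonotonic N) {x : Fin n → ℝ}
    {i : Fin n} (hi : 0 < x i) : 0 < normGradient N x i := by
  have hx0 : x ≠ 0 := fun h => by simp [h] at hi
  have h := normGradient_dotProduct_sub_le hd hx0 (x - Pi.single i (x i))
  have hlt : N (x - Pi.single i (x i)) < N x := by
    refine hm _ _ (fun j => ?_) fun he => ?_
    · by_cases hj : j = i
      · subst hj; simp
      · simp [hj]
    · have := congrFun he i
      simp only [Pi.abs_apply, Pi.sub_apply, Pi.single_eq_same, sub_self, abs_zero] at this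
      exact hi.ne' (abs_eq_zero.1 this.symm)
  rw [sub_sub_cancel_left, dotProduct_neg, dotProduct_single] at h
  by_contra hc
  nlinarith [mul_nonneg (neg_nonneg.2 (not_lt.1 hc)) hi.le]

theorem normGradient_nonneg (hd : NormDifferentiable N) (hm : StronglyMonotonic N)
    {x : Fin n → ℝ} (hx : 0 ≤ x) : 0 ≤ normGradient N x := by
  by_cases hx0 : x = 0
  · simp [normGradient, hx0]
  intro i
  -- the slopes of the norm at `x` in direction `eᵢ` are nonnegative by monotonicity
  have hl := ((hd x hx0).hasFDerivAt.hasLineDerivAt (Pi.single i 1)).tendsto_slope_zero_right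
  simp only [normGradient, hx0, if_false, Pi.zero_apply]
  refine ge_of_tendsto hl ?_
  filter_upwards [self_mem_nhdsWithin] with t ht
  have ht' : (0 : ℝ) < t := ht
  have hle : N x ≤ N (x + t • Pi.single i 1) := by
    have hs : (0 : Fin n → ℝ) ≤ t • Pi.single i 1 :=
      smul_nonneg ht'.le (Pi.single_nonneg.2 zero_le_one)
    refine hm.mono ?_
    rw [abs_of_nonneg hx, abs_of_nonneg (add_nonneg hx hs)]
    exact le_add_of_nonneg_right hs
  exact smul_nonneg (inv_nonneg.2 ht'.le) (sub_nonneg.2 hle)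

end Gradient

/-! ### Hilbert's projective metric on positive vectors -/

section Hilbert

variable {n : ℕ} {x y z : Fin n → ℝ}

theorem le_coneSup_smul (hy : ∀ i, 0 < y i) (hxy : ConeComparable x y) :
    x ≤ coneSup x y • y := by
  obtain ⟨-, C, -, hC, -, hxC⟩ := hxy
  intro i
  have h : x i / y i ≤ coneSup x y := by
    refine le_csInf ⟨C, hC, hxC⟩ fun D hD => ?_
    rw [div_le_iff₀ (hy i)]
    exact hD.2 i
  rw [div_le_iff₀ (hy i)] at h
  exact h

theorem coneSup_le {C : ℝ} (hC : 0 < C) (h : x ≤ C • y) : coneSup x y ≤ C :=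
  csInf_le ⟨0, fun _ hD => hD.1.le⟩ ⟨hC, h⟩

theorem ConeComparable.of_pos (hx : ∀ i, 0 < x i) (hy : ∀ i, 0 < y i) : ConeComparable x y := by
  have key : ∀ u v : Fin n → ℝ, (∀ i, 0 < u i) → (∀ i, 0 < v i) →
      ∃ C : ℝ, 0 < C ∧ u ≤ C • v := fun u v hu hv => by
    have hs : ∀ i ∈ Finset.univ, 0 ≤ u i / v i := fun i _ => (div_pos (hu i) (hv i)).le
    refine ⟨∑ i, u i / v i + 1, by linarith [Finset.sum_nonneg hs], fun i => ?_⟩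
    have h : u i / v i ≤ ∑ i, u i / v i + 1 := by
      linarith [Finset.single_le_sum hs (Finset.mem_univ i)]
    rw [div_le_iff₀ (hv i)] at h
    exact h
  obtain ⟨C, hC, h⟩ := key x y hx hy
  obtain ⟨c, hc, h'⟩ := key y x hy hx
  refine ⟨c⁻¹, C, inv_pos.2 hc, hC, fun i => ?_, h⟩
  have := h' i
  simp only [Pi.smul_apply, smul_eq_mul] at this ⊢
  rwa [inv_mul_le_iff₀ hc]

theorem coneSup_pos (hn : 0 < n) (hx : ∀ i, 0 < x i) (hy : ∀ i, 0 < y i) : 0 < coneSup x y := by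
  have h := le_coneSup_smul hy (.of_pos hx hy) ⟨0, hn⟩
  exact pos_of_mul_pos_left ((hx ⟨0, hn⟩).trans_le h) (hy _).le

theorem coneSup_le_mul (hn : 0 < n) (hx : ∀ i, 0 < x i) (hy : ∀ i, 0 < y i) (hz : ∀ i, 0 < z i) :
    coneSup x z ≤ coneSup x y * coneSup y z := by
  refine coneSup_le (mul_pos (coneSup_pos hn hx hy) (coneSup_pos hn hy hz)) ?_
  rw [mul_smul]
  exact (le_coneSup_smul hy (.of_pos hx hy)).trans
    (smul_le_smul_of_nonneg_left (le_coneSup_smul hz (.of_pos hy hz)) (coneSup_pos hn hx hy).le)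

theorem one_le_coneSup_mul (hn : 0 < n) (hx : ∀ i, 0 < x i) (hy : ∀ i, 0 < y i) :
    1 ≤ coneSup x y * coneSup y x := by
  have h := (le_coneSup_smul hy (.of_pos hx hy)).trans
    (smul_le_smul_of_nonneg_left (le_coneSup_smul hx (.of_pos hy hx)) (coneSup_pos hn hx hy).le)
  have h0 := h ⟨0, hn⟩
  rw [← mul_smul, Pi.smul_apply, smul_eq_mul] at h0
  exact (le_mul_iff_one_le_left (hx _)).1 h0

theorem hilbertDist_of_pos (hn : 0 < n) (hx : ∀ i, 0 < x i) (hy : ∀ i, 0 < y i) :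
    hilbertDist x y = ENNReal.ofReal (Real.log (coneSup x y * coneSup y x)) := by
  have hx0 : x ≠ 0 := fun h => (hx ⟨0, hn⟩).ne' (congrFun h _)
  simp [hilbertDist, hx0, ConeComparable.of_pos hx hy]

theorem hilbertDist_ne_top (hn : 0 < n) (hx : ∀ i, 0 < x i) (hy : ∀ i, 0 < y i) :
    hilbertDist x y ≠ ⊤ := by
  rw [hilbertDist_of_pos hn hx hy]
  exact ENNReal.ofReal_ne_top

theorem toReal_hilbertDist (hn : 0 < n) (hx : ∀ i, 0 < x i) (hy : ∀ i, 0 < y i) :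
    (hilbertDist x y).toReal = Real.log (coneSup x y * coneSup y x) := by
  rw [hilbertDist_of_pos hn hx hy,
    ENNReal.toReal_ofReal (Real.log_nonneg (one_le_coneSup_mul hn hx hy))]

theorem toReal_hilbertDist_triangle (hn : 0 < n) (hx : ∀ i, 0 < x i) (hy : ∀ i, 0 < y i)
    (hz : ∀ i, 0 < z i) :
    (hilbertDist x z).toReal ≤ (hilbertDist x y).toReal + (hilbertDist y z).toReal := by
  have hxy := coneSup_pos hn hx hy
  have hyx := coneSup_pos hn hy hx
  have hyz := coneSup_pos hn hy hz
  have hzy := coneSup_pos hn hz hy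
  have hxz := coneSup_pos hn hx hz
  have hzx := coneSup_pos hn hz hx
  rw [toReal_hilbertDist hn hx hz, toReal_hilbertDist hn hx hy, toReal_hilbertDist hn hy hz,
    ← Real.log_mul (mul_pos hxy hyx).ne' (mul_pos hyz hzy).ne']
  refine Real.log_le_log (mul_pos hxz hzx) ?_
  calc coneSup x z * coneSup z x
      ≤ (coneSup x y * coneSup y z) * (coneSup z y * coneSup y x) :=
        mul_le_mul (coneSup_le_mul hn hx hy hz) (coneSup_le_mul hn hz hy hx) hzx.le
          (mul_pos hxy hyz).le
    _ = _ := by ring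

/-- On positive unit vectors of a monotonic norm, Hilbert's metric bounds the difference in each
coordinate. -/
theorem abs_sub_le_hilbertDist_div {N : Seminorm ℝ (Fin n → ℝ)} (hN : ∀ x, N x = 0 → x = 0)
    (hmono : ∀ x y : Fin n → ℝ, |x| ≤ |y| → N x ≤ N y) (hn : 0 < n) (hx : ∀ i, 0 < x i)
    (hy : ∀ i, 0 < y i) (hNx : N x = 1) (hNy : N y = 1) (i : Fin n) :
    |x i - y i| ≤ (hilbertDist x y).toReal / N (Pi.single i 1) := by
  have hei : 0 < N (Pi.single i 1) := N.pos_of_ne_zero hN (by simp)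
  have one_le : ∀ {u v : Fin n → ℝ}, (∀ i, 0 < u i) → (∀ i, 0 < v i) → N u = 1 → N v = 1 →
      1 ≤ coneSup u v := by
    intro u v hu hv hNu hNv
    have hc := coneSup_pos hn hu hv
    have h := hmono u (coneSup u v • v) (by
      rw [abs_of_nonneg fun i => (hu i).le,
        abs_of_nonneg (smul_nonneg hc.le fun i => (hv i).le)]
      exact le_coneSup_smul hv (.of_pos hu hv))
    rwa [map_smul_eq_mul, hNu, hNv, mul_one, Real.norm_of_nonneg hc.le] at h
  have key : ∀ {u v : Fin n → ℝ}, (∀ i, 0 < u i) → (∀ i, 0 < v i) → N u = 1 → N v = 1 →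
      u i - v i ≤ Real.log (coneSup u v * coneSup v u) / N (Pi.single i 1) := by
    intro u v hu hv hNu hNv
    have hM : 0 < coneSup u v * coneSup v u :=
      mul_pos (coneSup_pos hn hu hv) (coneSup_pos hn hv hu)
    have h1 : u i ≤ coneSup u v * coneSup v u * v i := by
      have := le_coneSup_smul hv (.of_pos hu hv) i
      simp only [Pi.smul_apply, smul_eq_mul] at this
      nlinarith [one_le hv hu hNv hNu, mul_pos (coneSup_pos hn hu hv) (hv i)]
    -- `1 - 1 / M ≤ log M` turns the multiplicative bound into an additive one
    have h2 := Real.one_sub_inv_le_log_of_pos hM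
    have h3 : (coneSup u v * coneSup v u)⁻¹ * u i ≤ v i := by
      rwa [inv_mul_le_iff₀ hM]
    have h4 : u i * N (Pi.single i 1) ≤ 1 := by
      have : N (u i • Pi.single i 1) ≤ N u := hmono _ _ fun j => by
        by_cases hj : j = i
        · subst hj; simp
        · simp [hj]
      rwa [map_smul_eq_mul, Real.norm_of_nonneg (hu i).le, hNu] at this
    have hlog : 0 ≤ Real.log (coneSup u v * coneSup v u) :=
      Real.log_nonneg (one_le_coneSup_mul hn hu hv)
    have h5 : u i - v i ≤ u i * Real.log (coneSup u v * coneSup v u) := by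
      nlinarith [hu i]
    rw [le_div_iff₀ hei]
    calc (u i - v i) * N (Pi.single i 1)
        ≤ u i * Real.log (coneSup u v * coneSup v u) * N (Pi.single i 1) :=
          mul_le_mul_of_nonneg_right h5 hei.le
      _ = u i * N (Pi.single i 1) * Real.log (coneSup u v * coneSup v u) := by ring
      _ ≤ 1 * Real.log (coneSup u v * coneSup v u) := mul_le_mul_of_nonneg_right h4 hlog
      _ = _ := one_mul _
  rw [toReal_hilbertDist hn hx hy, abs_le']
  refine ⟨key hx hy hNx hNy, ?_⟩
  rw [neg_sub, mul_comm (coneSup x y)]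
  exact key hy hx hNy hNx

/-- The infimum defining the Birkhoff ratio may be used as a Lipschitz constant. -/
theorem hilbertDist_map_le {m : ℕ} {F : (Fin n → ℝ) → (Fin m → ℝ)} {c : ℝ≥0}
    (hF : birkhoffRatio F ≤ c) (hx : 0 ≤ x) (hy : 0 ≤ y) (hxy : ConeComparable x y)
    (hd : hilbertDist x y ≠ ⊤) : hilbertDist (F x) (F y) ≤ c * hilbertDist x y := by
  have key : ∀ b : ℝ≥0∞, c < b → hilbertDist (F x) (F y) ≤ b * hilbertDist x y := by
    intro b hb
    obtain ⟨-, ⟨C, -, rfl, hC⟩, hCb⟩ := sInf_lt_iff.1 (hF.trans_lt hb)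
    exact (hC x y hx hy hxy).trans (mul_le_mul_left hCb.le _)
  by_cases h0 : hilbertDist x y = 0
  · have := key ⊤ ENNReal.coe_lt_top
    rw [h0] at this ⊢
    simpa using this
  · rw [← ENNReal.div_le_iff_le_mul (.inl h0) (.inl hd)]
    refine le_of_forall_gt_imp_ge_of_dense fun b hb => ?_
    rw [ENNReal.div_le_iff_le_mul (.inl h0) (.inl hd)]
    exact key b hb

end Hilbert

/-! ### Clarke critical points of a quotient of norms -/

section Clarke

variable {n : ℕ}

theorem zero_mem_clarkeGradient_of_forall_le {f : (Fin n → ℝ) → ℝ} {x : Fin n → ℝ}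
    (h : ∀ z, f z ≤ f x) : 0 ∈ clarkeGradient f x := by
  intro v
  rw [zero_dotProduct, EReal.coe_zero]
  refine le_limsup_of_frequently_le ?_
  -- the difference quotients based at `x - t v` are nonnegative
  have ht : Tendsto (fun t : ℝ => (x - t • v, t)) (𝓝[>] 0) (𝓝 x ×ˢ 𝓝[>] (0 : ℝ)) := by
    refine Tendsto.prodMk ?_ tendsto_id
    have hc : Continuous fun t : ℝ => x - t • v := by fun_prop
    have := hc.tendsto 0
    rw [zero_smul, sub_zero] at this
    exact this.mono_left nhdsWithin_le_nhds
  refine ht.frequently (Eventually.frequently ?_)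
  filter_upwards [self_mem_nhdsWithin] with t ht'
  rw [sub_add_cancel]
  exact EReal.coe_nonneg.2 (div_nonneg (sub_nonneg.2 (h _)) (le_of_lt ht'))

/-- Monotonicity of the slopes of a seminorm, by convexity. -/
theorem Seminorm.slope_le_slope (p : Seminorm ℝ (Fin n → ℝ)) (z v : Fin n → ℝ) {t s : ℝ}
    (ht : 0 < t) (hts : t ≤ s) : (p (z + t • v) - p z) / t ≤ (p (z + s • v) - p z) / s := by
  have hs : 0 < s := ht.trans_le hts
  have hr : t / s ≤ 1 := (div_le_one hs).2 hts
  have e : z + t • v = (1 - t / s) • z + (t / s) • (z + s • v) := by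
    rw [smul_add, smul_smul, div_mul_cancel₀ _ hs.ne', sub_smul, one_smul]
    abel
  have h := map_add_le_add p ((1 - t / s) • z) ((t / s) • (z + s • v))
  rw [← e, map_smul_eq_mul, map_smul_eq_mul, Real.norm_of_nonneg (sub_nonneg.2 hr),
    Real.norm_of_nonneg (div_pos ht hs).le] at h
  rw [div_le_iff₀ ht]
  calc p (z + t • v) - p z ≤ t / s * (p (z + s • v) - p z) := by linarith
    _ = _ := by ring

/-- At a Clarke critical point of a quotient `g / b` of seminorms, the difference quotients in every
direction satisfy the first-order condition, with no limit taken. -/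
theorem criticalPoint_slope_nonneg (g b : Seminorm ℝ (Fin n → ℝ)) (hb : ∀ x, b x = 0 → x = 0)
    {y : Fin n → ℝ} (hy : y ≠ 0) (hcrit : 0 ∈ clarkeGradient (fun x => g x / b x) y)
    (v : Fin n → ℝ) {s : ℝ} (hs : 0 < s) :
    0 ≤ (g (y + s • v) - g y) * b y + g y * (b (y + s • -v) - b y) := by
  have hby : 0 < b y := b.pos_of_ne_zero hb hy
  have hgc := g.continuous_of_pi
  have hbc := b.continuous_of_pi
  -- `Q` dominates the difference quotients of `g / b` by monotonicity of the slopes of `g`, `b`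
  let Q : (Fin n → ℝ) × ℝ → ℝ := fun p =>
    ((g (p.1 + s • v) - g p.1) / s * b p.1 +
      g p.1 * ((b (p.1 + p.2 • v + s • -v) - b (p.1 + p.2 • v)) / s)) /
      (b (p.1 + p.2 • v) * b p.1)
  have hle : 𝓝 y ×ˢ 𝓝[>] (0 : ℝ) ≤ 𝓝 (y, (0 : ℝ)) := by
    rw [nhds_prod_eq]
    exact Filter.prod_mono le_rfl nhdsWithin_le_nhds
  have hQ : Tendsto Q (𝓝 y ×ˢ 𝓝[>] (0 : ℝ)) (𝓝 (Q (y, 0))) := by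
    have : ContinuousAt Q (y, 0) := by
      refine ContinuousAt.div (Continuous.continuousAt (by fun_prop))
        (Continuous.continuousAt (by fun_prop)) ?_
      simp only [zero_smul, add_zero]
      exact (mul_pos hby hby).ne'
    exact this.tendsto.mono_left hle
  have hev : ∀ᶠ p : (Fin n → ℝ) × ℝ in 𝓝 y ×ˢ 𝓝[>] (0 : ℝ),
      ((((g (p.1 + p.2 • v) / b (p.1 + p.2 • v) - g p.1 / b p.1) / p.2 : ℝ) : EReal)) ≤ Q p := by
    have h1 : ∀ᶠ p : (Fin n → ℝ) × ℝ in 𝓝 y ×ˢ 𝓝[>] (0 : ℝ), 0 < b p.1 := by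
      have : Continuous fun p : (Fin n → ℝ) × ℝ => b p.1 := by fun_prop
      exact hle (this.continuousAt.eventually (lt_mem_nhds hby))
    have h2 : ∀ᶠ p : (Fin n → ℝ) × ℝ in 𝓝 y ×ˢ 𝓝[>] (0 : ℝ), 0 < b (p.1 + p.2 • v) := by
      have : Continuous fun p : (Fin n → ℝ) × ℝ => b (p.1 + p.2 • v) := by fun_prop
      exact hle (this.continuousAt.eventually (lt_mem_nhds (by simpa using hby)))
    have h3 : ∀ᶠ p : (Fin n → ℝ) × ℝ in 𝓝 y ×ˢ 𝓝[>] (0 : ℝ), p.2 ∈ Set.Ioo 0 s :=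
      tendsto_snd.eventually (Ioo_mem_nhdsGT hs)
    filter_upwards [h1, h2, h3] with p hp1 hp2 hp3
    have hg := g.slope_le_slope p.1 v hp3.1 hp3.2.le
    have hb' := b.slope_le_slope (p.1 + p.2 • v) (-v) hp3.1 hp3.2.le
    rw [show p.1 + p.2 • v + p.2 • -v = p.1 by simp] at hb'
    have hp0 := hp3.1.ne'
    have e : (g (p.1 + p.2 • v) / b (p.1 + p.2 • v) - g p.1 / b p.1) / p.2 =
        ((g (p.1 + p.2 • v) - g p.1) / p.2 * b p.1 +
          g p.1 * ((b p.1 - b (p.1 + p.2 • v)) / p.2)) / (b (p.1 + p.2 • v) * b p.1) := by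
      field_simp
      ring
    rw [EReal.coe_le_coe_iff, e]
    refine div_le_div_of_nonneg_right (add_le_add ?_ ?_) (mul_pos hp2 hp1).le
    · exact mul_le_mul_of_nonneg_right hg hp1.le
    · exact mul_le_mul_of_nonneg_left hb' (apply_nonneg g _)
  have hlim : clarkeDeriv (fun x => g x / b x) y v ≤ Q (y, 0) := by
    have hQ' : Tendsto (fun p => (Q p : EReal)) (𝓝 y ×ˢ 𝓝[>] (0 : ℝ)) (𝓝 (Q (y, 0) : EReal)) :=
      (continuous_coe_real_ereal.tendsto _).comp hQ
    exact (limsup_le_limsup hev).trans hQ'.limsup_eq.le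
  have h0 := (hcrit v).trans hlim
  rw [zero_dotProduct, EReal.coe_le_coe_iff] at h0
  simp only [Q, zero_smul, add_zero] at h0
  have h1 : 0 ≤ ((g (y + s • v) - g y) * b y + g y * (b (y + s • -v) - b y)) /
      (s * (b y * b y)) := by
    convert h0 using 1
    field_simp
  have hpos : 0 < s * (b y * b y) := by positivity
  rwa [le_div_iff₀ hpos, zero_mul] at h1

/-- At a Clarke critical point `y` of `g / b` where `g` is differentiable, the functional
`(b y) ∇g(y)` is bounded by `(g y) b`. -/
theorem criticalPoint_fderiv_le (g b : Seminorm ℝ (Fin n → ℝ)) (hb : ∀ x, b x = 0 → x = 0)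
    {y : Fin n → ℝ} (hy : y ≠ 0) (hcrit : 0 ∈ clarkeGradient (fun x => g x / b x) y)
    {L : (Fin n → ℝ) →L[ℝ] ℝ} (hL : HasFDerivAt g L y) (u : Fin n → ℝ) :
    b y * L u ≤ g y * b u := by
  have hl := (hL.hasLineDerivAt (-u)).tendsto_slope_zero_right.const_mul (b y)
  rw [map_neg, mul_neg] at hl
  have h : -(g y * b u) ≤ -(b y * L u) := by
    refine ge_of_tendsto hl ?_
    filter_upwards [self_mem_nhdsWithin] with s hs
    have hs' : (0 : ℝ) < s := hs
    have h := criticalPoint_slope_nonneg g b hb hy hcrit (-u) hs'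
    rw [neg_neg] at h
    have h2 : b (y + s • u) ≤ b y + s * b u := by
      refine (map_add_le_add b _ _).trans ?_
      rw [map_smul_eq_mul, Real.norm_of_nonneg hs'.le]
    rw [smul_eq_mul, ← mul_assoc, mul_comm (b y), mul_assoc, le_inv_mul_iff₀ hs']
    nlinarith [apply_nonneg g y]
  linarith

end Clarke

/-! ### Nonnegative matrices with irreducible Gram matrix -/

section Irreducible

theorem Matrix.IsIrreducible.mem_of_mem {n : ℕ} {B : Matrix (Fin n) (Fin n) ℝ}
    (hB : B.IsIrreducible) {Z : Set (Fin n)} (hZ : ∀ j ∈ Z, ∀ k, 0 < B j k → k ∈ Z) {j : Fin n}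
    (hj : j ∈ Z) (k : Fin n) : k ∈ Z := by
  let : Quiver (Fin n) := B.toQuiver
  obtain ⟨p, -⟩ := hB.connected j k
  induction p with
  | nil => exact hj
  | cons q e ih => exact hZ _ ih _ e.down

theorem Matrix.IsIrreducible.exists_pos_left {n : ℕ} {B : Matrix (Fin n) (Fin n) ℝ}
    (hB : B.IsIrreducible) (j : Fin n) : ∃ k, 0 < B k j := by
  let : Quiver (Fin n) := B.toQuiver
  obtain ⟨p, hp⟩ := hB.connected j j
  cases p with
  | nil => simp at hp
  | cons q e => exact ⟨_, e.down⟩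

variable {m n : ℕ} {A : Matrix (Fin m) (Fin n) ℝ}

theorem exists_pos_of_isIrreducible_gram (hA : ∀ i j, 0 ≤ A i j) (hirr : (Aᵀ * A).IsIrreducible)
    (j : Fin n) : ∃ i, 0 < A i j := by
  by_contra! h
  have h0 : ∀ i, A i j = 0 := fun i => le_antisymm (h i) (hA i j)
  obtain ⟨k, hk⟩ := hirr.exists_pos_left j
  simp [Matrix.mul_apply, h0] at hk

theorem mulVec_nonneg (hA : ∀ i j, 0 ≤ A i j) {x : Fin n → ℝ} (hx : 0 ≤ x) : 0 ≤ A *ᵥ x :=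
  fun i => show 0 ≤ ∑ j, A i j * x j from
    Finset.sum_nonneg fun j _ => mul_nonneg (hA i j) (hx j)

theorem mulVec_pos_of_pos (hA : ∀ i j, 0 ≤ A i j) {x : Fin n → ℝ} (hx : 0 ≤ x) {i : Fin m}
    {j : Fin n} (hij : 0 < A i j) (hj : 0 < x j) : 0 < (A *ᵥ x) i :=
  (mul_pos hij hj).trans_le <|
    Finset.single_le_sum (f := fun j => A i j * x j) (fun k _ => mul_nonneg (hA i k) (hx k))
      (Finset.mem_univ j)

theorem mulVec_ne_zero (hA : ∀ i j, 0 ≤ A i j) (hirr : (Aᵀ * A).IsIrreducible) {x : Fin n → ℝ}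
    (hx : 0 ≤ x) (hx0 : x ≠ 0) : A *ᵥ x ≠ 0 := by
  obtain ⟨j, hj⟩ := Function.ne_iff.1 hx0
  obtain ⟨i, hi⟩ := exists_pos_of_isIrreducible_gram hA hirr j
  intro h
  exact (mulVec_pos_of_pos hA hx hi (lt_of_le_of_ne (hx j) hj.symm)).ne' (congrFun h i)

end Irreducible

/-! ### The power iterator and its fixed points -/

section PowerMap

variable {m n : ℕ} {A : Matrix (Fin m) (Fin n) ℝ} {α : Seminorm ℝ (Fin m → ℝ)}
  {β : Seminorm ℝ (Fin n → ℝ)}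

theorem transpose_mulVec_dotProduct (A : Matrix (Fin m) (Fin n) ℝ) (u : Fin m → ℝ)
    (z : Fin n → ℝ) : (Aᵀ *ᵥ u) ⬝ᵥ z = u ⬝ᵥ (A *ᵥ z) := by
  rw [Matrix.mulVec_transpose, Matrix.dotProduct_mulVec]

theorem transpose_mulVec_normGradient_ne_zero (hα : ∀ x, α x = 0 → x = 0)
    (hαd : NormDifferentiable α) {x : Fin n → ℝ} (hx : A *ᵥ x ≠ 0) :
    Aᵀ *ᵥ normGradient α (A *ᵥ x) ≠ 0 := by
  intro h
  have h1 := transpose_mulVec_dotProduct A (normGradient α (A *ᵥ x)) x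
  rw [h, zero_dotProduct, normGradient_dotProduct_self hαd hx] at h1
  exact (α.pos_of_ne_zero hα hx).ne h1

theorem norm_powerMap (hn : 0 < n) (hα : ∀ x, α x = 0 → x = 0) (hβ : ∀ x, β x = 0 → x = 0)
    (hαd : NormDifferentiable α) (hβd : NormDifferentiable (dualNorm β)) {x : Fin n → ℝ}
    (hx : A *ᵥ x ≠ 0) : β (powerMap α β A x) = 1 := by
  have hw := transpose_mulVec_normGradient_ne_zero hα hαd hx
  have hN : NormDifferentiable (dualSeminorm hn β hβ) := hβd
  refine le_antisymm (le_one_of_dotProduct_le_dualNorm hn hβ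
    (normGradient_dotProduct_le hN hw)) ?_
  have h1 := normGradient_dotProduct_self hN hw
  rw [coe_dualSeminorm] at h1
  have h2 := dotProduct_le_mul_dualNorm hβ (powerMap α β A x) (Aᵀ *ᵥ normGradient α (A *ᵥ x))
  rw [powerMap, h1] at h2
  -- the dual norm is positive on nonzero vectors, since `w · w > 0`
  have hpos : 0 < dualNorm β (Aᵀ *ᵥ normGradient α (A *ᵥ x)) := by
    have h3 := dotProduct_le_mul_dualNorm hβ (Aᵀ *ᵥ normGradient α (A *ᵥ x))
      (Aᵀ *ᵥ normGradient α (A *ᵥ x))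
    have h4 : 0 < (Aᵀ *ᵥ normGradient α (A *ᵥ x)) ⬝ᵥ (Aᵀ *ᵥ normGradient α (A *ᵥ x)) :=
      lt_of_le_of_ne (Finset.sum_nonneg fun i _ => mul_self_nonneg _)
        fun h => hw (dotProduct_self_eq_zero.1 h.symm)
    exact pos_of_mul_pos_right (h4.trans_le h3) (apply_nonneg β _)
  exact (le_mul_iff_one_le_left hpos).1 h2

/-- A unit vector `x` is fixed by the power iterator once `Aᵀ J_α(A x)` is bounded by
`‖A x‖_α ‖·‖_β`: it is then the subgradient of the dual norm at that vector. -/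
theorem powerMap_eq_self (hn : 0 < n) (hα : ∀ x, α x = 0 → x = 0) (hβ : ∀ x, β x = 0 → x = 0)
    (hαd : NormDifferentiable α) (hβd : NormDifferentiable (dualNorm β)) {x : Fin n → ℝ}
    (hx : A *ᵥ x ≠ 0) (hx1 : β x = 1)
    (h : ∀ z, (Aᵀ *ᵥ normGradient α (A *ᵥ x)) ⬝ᵥ z ≤ α (A *ᵥ x) * β z) :
    powerMap α β A x = x := by
  have hw := transpose_mulVec_normGradient_ne_zero hα hαd hx
  have hN : NormDifferentiable (dualSeminorm hn β hβ) := hβd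
  have hle : ∀ z, x ⬝ᵥ z ≤ dualNorm β z := fun z => by
    simpa [hx1] using dotProduct_le_mul_dualNorm hβ x z
  have hxw : x ⬝ᵥ (Aᵀ *ᵥ normGradient α (A *ᵥ x)) = α (A *ᵥ x) := by
    rw [dotProduct_comm, transpose_mulVec_dotProduct, normGradient_dotProduct_self hαd hx]
  refine (eq_normGradient hN hw hle (le_antisymm (hle _) ?_)).symm
  rw [hxw]
  exact dualNorm_le hn hβ fun z => by rw [dotProduct_comm]; exact h z

/-- The power iterator is positive in every coordinate in which `Aᵀ J_α(A x)` is, and the latter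
is positive wherever a row of `A` meeting the support of `x` is. -/
theorem powerMap_apply_pos (hn : 0 < n) (hβ : ∀ x, β x = 0 → x = 0) (hA : ∀ i j, 0 ≤ A i j)
    (hαd : NormDifferentiable α) (hβd : NormDifferentiable (dualNorm β))
    (hαm : StronglyMonotonic α) (hβm : StronglyMonotonic (dualNorm β)) {x : Fin n → ℝ}
    (hx : 0 ≤ x) {i : Fin m} {j k : Fin n} (hij : 0 < A i j) (hik : 0 < A i k) (hk : 0 < x k) :
    0 < powerMap α β A x j := by
  have hJ : 0 ≤ normGradient α (A *ᵥ x) := normGradient_nonneg hαd hαm (mulVec_nonneg hA hx)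
  have hJi : 0 < normGradient α (A *ᵥ x) i :=
    normGradient_pos hαd hαm (mulVec_pos_of_pos hA hx hik hk)
  exact normGradient_pos (N := dualSeminorm hn β hβ) hβd hβm
    (mulVec_pos_of_pos (A := Aᵀ) (fun i j => hA j i) hJ hij hJi)

theorem powerMap_pos (hn : 0 < n) (hβ : ∀ x, β x = 0 → x = 0) (hA : ∀ i j, 0 ≤ A i j)
    (hirr : (Aᵀ * A).IsIrreducible)
    (hαd : NormDifferentiable α) (hβd : NormDifferentiable (dualNorm β))
    (hαm : StronglyMonotonic α) (hβm : StronglyMonotonic (dualNorm β)) {x : Fin n → ℝ}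
    (hx : ∀ i, 0 < x i) (j : Fin n) : 0 < powerMap α β A x j := by
  obtain ⟨i, hi⟩ := exists_pos_of_isIrreducible_gram hA hirr j
  exact powerMap_apply_pos hn hβ hA hαd hβd hαm hβm (fun i => (hx i).le) hi hi (hx j)

/-- A nonzero nonnegative fixed point is positive: its zero set is closed under the graph of the
irreducible matrix `Aᵀ A`. -/
theorem pos_of_powerMap_eq_self (hn : 0 < n) (hβ : ∀ x, β x = 0 → x = 0) (hA : ∀ i j, 0 ≤ A i j)
    (hirr : (Aᵀ * A).IsIrreducible)
    (hαd : NormDifferentiable α) (hβd : NormDifferentiable (dualNorm β))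
    (hαm : StronglyMonotonic α) (hβm : StronglyMonotonic (dualNorm β)) {x : Fin n → ℝ}
    (hx : 0 ≤ x) (hx0 : x ≠ 0) (hfix : powerMap α β A x = x) (i : Fin n) : 0 < x i := by
  refine lt_of_le_of_ne (hx i) fun hi => hx0 ?_
  refine funext <| hirr.mem_of_mem (Z := {j | x j = 0}) (fun j hj k hjk => ?_) hi.symm
  by_contra hk
  obtain ⟨l, -, hl⟩ := Finset.exists_ne_zero_of_sum_ne_zero (Matrix.mul_apply (M := Aᵀ) ▸ hjk).ne'
  have hlj : 0 < A l j := lt_of_le_of_ne (hA l j) (left_ne_zero_of_mul hl).symm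
  have hlk : 0 < A l k := lt_of_le_of_ne (hA l k) (right_ne_zero_of_mul hl).symm
  have h := powerMap_apply_pos hn hβ hA hαd hβd hαm hβm hx hlj hlk
    (lt_of_le_of_ne (hx k) (Ne.symm hk))
  rw [hfix] at h
  exact h.ne' hj

/-- The operator norm is attained at a nonnegative unit vector. -/
theorem exists_nonneg_maximizer (hn : 0 < n) (hβ : ∀ x, β x = 0 → x = 0) (hA : ∀ i j, 0 ≤ A i j)
    (hαm : StronglyMonotonic α) (hβm : StronglyMonotonic (dualNorm β)) :
    ∃ x : Fin n → ℝ, 0 ≤ x ∧ β x = 1 ∧ ∀ z, α (A *ᵥ z) ≤ α (A *ᵥ x) * β z := by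
  have hαc := α.continuous_of_pi
  have hβc := β.continuous_of_pi
  have hscale : ∀ z : Fin n → ℝ, z ≠ 0 → β ((β z)⁻¹ • z) = 1 := fun z hz => by
    have := β.pos_of_ne_zero hβ hz
    rw [map_smul_eq_mul, Real.norm_of_nonneg (inv_pos.2 this).le, inv_mul_cancel₀ this.ne']
  have hcomp : IsCompact {x : Fin n → ℝ | β x = 1} := by
    obtain ⟨c, hc, h⟩ := β.exists_pos_mul_norm_le hβ
    refine (isCompact_closedBall (0 : Fin n → ℝ) c⁻¹).of_isClosed_subset
      (isClosed_eq hβc continuous_const) fun x hx => ?_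
    have hx' : β x = 1 := hx
    rw [mem_closedBall_zero_iff, ← mul_one c⁻¹, le_inv_mul_iff₀ hc, ← hx']
    exact h x
  obtain ⟨u, hu, hmax⟩ := hcomp.exists_isMaxOn
    ⟨_, hscale (Pi.single ⟨0, hn⟩ 1) (by simp)⟩
    (f := fun x => α (A *ᵥ x)) (by fun_prop)
  -- replace the maximizer by its entrywise absolute value
  have habs : β |u| = 1 := by
    rw [← show β u = 1 from hu]
    exact le_antisymm (mono_of_stronglyMonotonic_dualNorm hn hβ hβm (abs_abs u).le)
      (mono_of_stronglyMonotonic_dualNorm hn hβ hβm (abs_abs u).ge)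
  have hAabs : α (A *ᵥ u) ≤ α (A *ᵥ |u|) := by
    refine hαm.mono fun i => ?_
    rw [abs_of_nonneg (mulVec_nonneg hA (abs_nonneg u))]
    change |∑ j, A i j * u j| ≤ ∑ j, A i j * |u j|
    refine (Finset.abs_sum_le_sum_abs _ _).trans (Finset.sum_le_sum fun j _ => ?_)
    rw [abs_mul, abs_of_nonneg (hA i j)]
  refine ⟨|u|, abs_nonneg u, habs, fun z => ?_⟩
  by_cases hz : z = 0
  · simp [hz]
  have hbz := β.pos_of_ne_zero hβ hz
  have h : α (A *ᵥ ((β z)⁻¹ • z)) ≤ α (A *ᵥ |u|) := le_trans (hmax (hscale z hz)) hAabs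
  rwa [Matrix.mulVec_smul, map_smul_eq_mul, Real.norm_of_nonneg (inv_pos.2 hbz).le,
    inv_mul_le_iff₀ hbz, mul_comm] at h

/-- Nonnegative critical points of `f_A`, once normalized, are fixed by the power iterator. -/
theorem powerMap_eq_self_of_isCriticalPoint (hn : 0 < n) (hα : ∀ x, α x = 0 → x = 0)
    (hβ : ∀ x, β x = 0 → x = 0) (hA : ∀ i j, 0 ≤ A i j) (hirr : (Aᵀ * A).IsIrreducible)
    (hαd : NormDifferentiable α) (hβd : NormDifferentiable (dualNorm β)) {y : Fin n → ℝ}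
    (hy : 0 ≤ y) (hcrit : IsCriticalPoint α β A y) :
    powerMap α β A ((β y)⁻¹ • y) = (β y)⁻¹ • y := by
  obtain ⟨hy0, hcrit⟩ := hcrit
  have hby := β.pos_of_ne_zero hβ hy0
  have hAy := mulVec_ne_zero hA hirr hy hy0
  have hgrad : HasFDerivAt (α.comp A.mulVecLin)
      ((fderiv ℝ α (A *ᵥ y)).comp (LinearMap.toContinuousLinearMap A.mulVecLin)) y :=
    HasFDerivAt.comp y (f := A.mulVecLin) (hαd _ hAy).hasFDerivAt
      (LinearMap.toContinuousLinearMap A.mulVecLin).hasFDerivAt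
  have hle := criticalPoint_fderiv_le (α.comp A.mulVecLin) β hβ hy0 hcrit hgrad
  have hz0 : (β y)⁻¹ • y ≠ 0 := smul_ne_zero (inv_pos.2 hby).ne' hy0
  have hz : 0 ≤ (β y)⁻¹ • y := smul_nonneg (inv_pos.2 hby).le hy
  have hz1 : β ((β y)⁻¹ • y) = 1 := by
    rw [map_smul_eq_mul, Real.norm_of_nonneg (inv_pos.2 hby).le, inv_mul_cancel₀ hby.ne']
  have hAz := mulVec_ne_zero hA hirr hz hz0
  refine powerMap_eq_self hn hα hβ hαd hβd hAz hz1 fun u => ?_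
  -- the gradient of a norm is constant along rays
  have hJ : normGradient α (A *ᵥ ((β y)⁻¹ • y)) = normGradient α (A *ᵥ y) := by
    refine (eq_normGradient hαd hAz (normGradient_dotProduct_le hαd hAy) ?_).symm
    rw [Matrix.mulVec_smul, dotProduct_smul, normGradient_dotProduct_self hαd hAy,
      map_smul_eq_mul, Real.norm_of_nonneg (inv_pos.2 hby).le, smul_eq_mul]
  have hu : β y * fderiv ℝ α (A *ᵥ y) (A *ᵥ u) ≤ α (A *ᵥ y) * β u := hle u
  rw [fderiv_eq_normGradient_dotProduct _ hAy, mul_comm, ← le_div_iff₀ hby] at hu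
  rw [hJ, transpose_mulVec_dotProduct, Matrix.mulVec_smul, map_smul_eq_mul,
    Real.norm_of_nonneg (inv_pos.2 hby).le]
  calc _ ≤ _ := hu
    _ = _ := by ring

end PowerMap

/-! ### Convergence of the power sequence -/

section Convergence

variable {n : ℕ} {F : (Fin n → ℝ) → Fin n → ℝ} {τ : ℝ≥0} {x y : Fin n → ℝ}

theorem toReal_hilbertDist_map_le (hn : 0 < n) (hF : birkhoffRatio F ≤ τ) (hx : ∀ i, 0 < x i)
    (hy : ∀ i, 0 < y i) :
    (hilbertDist (F x) (F y)).toReal ≤ τ * (hilbertDist x y).toReal := by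
  have hd := hilbertDist_ne_top hn hx hy
  have h := hilbertDist_map_le hF (fun i => (hx i).le) (fun i => (hy i).le) (.of_pos hx hy) hd
  have := ENNReal.toReal_mono (ENNReal.mul_ne_top ENNReal.coe_ne_top hd) h
  rwa [ENNReal.toReal_mul, ENNReal.coe_toReal] at this

theorem eq_of_fixed_of_birkhoffRatio_lt_one {N : Seminorm ℝ (Fin n → ℝ)}
    (hN : ∀ x, N x = 0 → x = 0) (hmono : ∀ x y : Fin n → ℝ, |x| ≤ |y| → N x ≤ N y) (hn : 0 < n)
    (hF : birkhoffRatio F ≤ τ) (hτ : τ < 1) (hx : ∀ i, 0 < x i) (hy : ∀ i, 0 < y i)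
    (hNx : N x = 1) (hNy : N y = 1) (hFx : F x = x) (hFy : F y = y) : x = y := by
  have h := toReal_hilbertDist_map_le hn hF hx hy
  rw [hFx, hFy] at h
  have hτ' : (τ : ℝ) < 1 := by exact_mod_cast hτ
  have h0 : (hilbertDist x y).toReal = 0 := by
    have : 0 ≤ (hilbertDist x y).toReal := ENNReal.toReal_nonneg
    nlinarith
  ext i
  have := abs_sub_le_hilbertDist_div hN hmono hn hx hy hNx hNy i
  rw [h0, zero_div] at this
  exact sub_eq_zero.1 (abs_nonpos_iff.1 this)

/-- The a priori error estimate for a contraction of Hilbert's metric with fixed point `y`. -/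
theorem toReal_hilbertDist_iterate_le (hn : 0 < n) (hF : birkhoffRatio F ≤ τ) (hτ : τ < 1)
    {u : ℕ → Fin n → ℝ} (hu : ∀ k, u (k + 1) = F (u k)) (hpos : ∀ k i, 0 < u k i)
    (hy : ∀ i, 0 < y i) (hFy : F y = y) (k : ℕ) :
    (hilbertDist (u k) y).toReal ≤
      (τ : ℝ) ^ k * ((hilbertDist (u 0) (u 1)).toReal / (1 - τ)) := by
  have hτ' : (0 : ℝ) < 1 - τ := sub_pos.2 (by exact_mod_cast hτ)
  have step : ∀ k, (hilbertDist (u (k + 1)) y).toReal ≤ τ * (hilbertDist (u k) y).toReal :=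
    fun k => by
      have := toReal_hilbertDist_map_le hn hF (hpos k) hy
      rwa [hFy, ← hu] at this
  induction k with
  | zero =>
    have h1 := toReal_hilbertDist_triangle hn (hpos 0) (hpos 1) hy
    have h2 := step 0
    rw [pow_zero, one_mul, le_div_iff₀ hτ']
    rw [zero_add] at h2
    linarith
  | succ k ih =>
    calc _ ≤ _ := step k
      _ ≤ τ * ((τ : ℝ) ^ k * ((hilbertDist (u 0) (u 1)).toReal / (1 - τ))) :=
        mul_le_mul_of_nonneg_left ih τ.2
      _ = _ := by ring

theorem le_supNormRatio_mul_norm (N : Seminorm ℝ (Fin n → ℝ)) (x : Fin n → ℝ) :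
    N x ≤ supNormRatio N * ‖x‖ := by
  by_cases hx : x = 0
  · simp [hx]
  obtain ⟨C, -, hC⟩ := N.bound_of_continuous_normedSpace N.continuous_of_pi
  have hb : BddAbove (Set.range fun x : {x : Fin n → ℝ // x ≠ 0} => N x.1 / ‖x.1‖) := by
    refine ⟨C, ?_⟩
    rintro _ ⟨⟨z, hz⟩, rfl⟩
    exact (div_le_iff₀ (norm_pos_iff.2 hz)).2 (hC z)
  exact (div_le_iff₀ (norm_pos_iff.2 hx)).1 (le_ciSup hb ⟨x, hx⟩)

end Convergence


theorem mainTheorem1 {m n : ℕ} (hn : 0 < n)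
    (A : Matrix (Fin m) (Fin n) ℝ) (hA : ∀ i j, 0 ≤ A i j) (hirr : (Aᵀ * A).IsIrreducible)
    (α : Seminorm ℝ (Fin m → ℝ)) (hα : ∀ x, α x = 0 → x = 0)
    (β : Seminorm ℝ (Fin n → ℝ)) (hβ : ∀ x, β x = 0 → x = 0)
    (hαd : NormDifferentiable α) (hβd : NormDifferentiable (dualNorm β))
    (hαm : StronglyMonotonic α) (hβm : StronglyMonotonic (dualNorm β))
    (τ : ℝ≥0) (hτ : τ < 1) (hκ : birkhoffRatio (powerMap α β A) ≤ τ) :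
    ∃ xp : Fin n → ℝ,
      -- `xp` is a critical point, positive, and the only nonnegative one up to scaling
      (∀ i, 0 < xp i) ∧ β xp = 1 ∧ IsCriticalPoint α β A xp ∧
      (∀ y : Fin n → ℝ, 0 ≤ y → IsCriticalPoint α β A y → y = β y • xp) ∧
      -- the matrix norm is a maximum, and it is attained at `xp`
      (∀ x : Fin n → ℝ, x ≠ 0 → normRatio α β A x ≤ normRatio α β A xp) ∧
      normRatio α β A xp = mixedNorm α β A ∧
      -- convergence of the power sequence from every positive starting vector
      ∀ x₀ : Fin n → ℝ, (∀ i, 0 < x₀ i) →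
        hilbertDist (powerSeq α β A x₀ 0) (powerSeq α β A x₀ 1) ≠ ⊤ ∧
        (∀ k : ℕ, ‖powerSeq α β A x₀ k - xp‖ ≤ (τ : ℝ) ^ k * rateConst α β A τ x₀) ∧
        (∀ k : ℕ,
          (1 - (τ : ℝ) ^ k * (rateConst α β A τ x₀ * supNormRatio β)) * mixedNorm α β A
              ≤ α (A *ᵥ powerSeq α β A x₀ k) ∧
            α (A *ᵥ powerSeq α β A x₀ k) ≤ mixedNorm α β A) ∧
        Tendsto (powerSeq α β A x₀) atTop (𝓝 xp) := by
  have hmono : ∀ x y : Fin n → ℝ, |x| ≤ |y| → β x ≤ β y := fun x y =>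
    mono_of_stronglyMonotonic_dualNorm hn hβ hβm
  obtain ⟨xp, hxp, hxp1, hmax⟩ := exists_nonneg_maximizer (A := A) hn hβ hA hαm hβm
  have hxp0 : xp ≠ 0 := by
    rintro rfl
    simp at hxp1
  have hAxp := mulVec_ne_zero hA hirr hxp hxp0
  -- at a maximizer, `⟨Aᵀ J_α(A xp), z⟩ = ⟨J_α(A xp), A z⟩ ≤ ‖A z‖_α ≤ ‖A‖ ‖z‖_β`
  have hfix : powerMap α β A xp = xp :=
    powerMap_eq_self hn hα hβ hαd hβd hAxp hxp1 fun z => by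
      rw [transpose_mulVec_dotProduct]
      exact (normGradient_dotProduct_le hαd hAxp _).trans (hmax z)
  have hpos := pos_of_powerMap_eq_self hn hβ hA hirr hαd hβd hαm hβm hxp hxp0 hfix
  have hval : normRatio α β A xp = α (A *ᵥ xp) := by rw [normRatio, hxp1, div_one]
  have hratio : ∀ x, normRatio α β A x ≤ normRatio α β A xp := fun x => by
    by_cases hx : x = 0
    · rw [hval, hx, normRatio, map_zero, div_zero]
      exact apply_nonneg α _
    · rw [hval, normRatio, div_le_iff₀ (β.pos_of_ne_zero hβ hx)]
      exact hmax x
  have hnorm : normRatio α β A xp = mixedNorm α β A := by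
    have : Nonempty {x : Fin n → ℝ // x ≠ 0} := ⟨⟨xp, hxp0⟩⟩
    exact le_antisymm
      (le_ciSup (f := fun x : {x : Fin n → ℝ // x ≠ 0} => normRatio α β A x.1)
        ⟨normRatio α β A xp, by rintro _ ⟨x, rfl⟩; exact hratio x.1⟩ ⟨xp, hxp0⟩)
      (ciSup_le fun x => hratio x.1)
  refine ⟨xp, hpos, hxp1, ⟨hxp0, zero_mem_clarkeGradient_of_forall_le hratio⟩,
    fun y hy hcrit => ?_, fun x _ => hratio x, hnorm, fun x₀ hx₀ => ?_⟩
  · have hby := β.pos_of_ne_zero hβ hcrit.1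
    have hyfix := powerMap_eq_self_of_isCriticalPoint hn hα hβ hA hirr hαd hβd hy hcrit
    have hy0 : (β y)⁻¹ • y ≠ 0 := smul_ne_zero (inv_pos.2 hby).ne' hcrit.1
    have hy1 : β ((β y)⁻¹ • y) = 1 := by
      rw [map_smul_eq_mul, Real.norm_of_nonneg (inv_pos.2 hby).le, inv_mul_cancel₀ hby.ne']
    have hypos := pos_of_powerMap_eq_self hn hβ hA hirr hαd hβd hαm hβm
      (smul_nonneg (inv_pos.2 hby).le hy) hy0 hyfix
    rw [← eq_of_fixed_of_birkhoffRatio_lt_one hβ hmono hn hκ hτ hypos hpos hy1 hxp1 hyfix hfix,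
      smul_inv_smul₀ hby.ne']
  · have hx₀0 : x₀ ≠ 0 := fun h => (hx₀ ⟨0, hn⟩).ne' (congrFun h _)
    have hb₀ := β.pos_of_ne_zero hβ hx₀0
    have hseq : ∀ k i, 0 < powerSeq α β A x₀ k i := by
      intro k
      induction k with
      | zero => exact fun i => mul_pos (inv_pos.2 hb₀) (hx₀ i)
      | succ k ih => exact powerMap_pos hn hβ hA hirr hαd hβd hαm hβm ih
    have hseq1 : ∀ k, β (powerSeq α β A x₀ k) = 1 := by
      intro k
      cases k with
      | zero =>
        rw [powerSeq, map_smul_eq_mul, Real.norm_of_nonneg (inv_pos.2 hb₀).le,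
          inv_mul_cancel₀ hb₀.ne']
      | succ k =>
        exact norm_powerMap hn hα hβ hαd hβd (mulVec_ne_zero hA hirr (fun i => (hseq k i).le)
          fun h => (hseq k ⟨0, hn⟩).ne' (congrFun h _))
    have hτ' : (τ : ℝ) < 1 := by exact_mod_cast hτ
    have hrate : ∀ k, ‖powerSeq α β A x₀ k - xp‖ ≤ (τ : ℝ) ^ k * rateConst α β A τ x₀ := by
      intro k
      have hi : ∀ i, |powerSeq α β A x₀ k i - xp i| ≤ (τ : ℝ) ^ k * rateConst α β A τ x₀ := by
        intro i
        have hei : 0 < β (Pi.single i 1) := β.pos_of_ne_zero hβ (by simp)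
        refine (abs_sub_le_hilbertDist_div hβ hmono hn (hseq k) hpos (hseq1 k) hxp1 i).trans ?_
        refine (div_le_div_of_nonneg_right (toReal_hilbertDist_iterate_le hn hκ hτ
          (fun _ => rfl) hseq hpos hfix k) hei.le).trans ?_
        rw [mul_div_assoc, div_div]
        exact mul_le_mul_of_nonneg_left (le_ciSup (f := fun i : Fin n =>
          (hilbertDist (powerSeq α β A x₀ 0) (powerSeq α β A x₀ 1)).toReal /
            ((1 - (τ : ℝ)) * β (Pi.single i 1))) (Set.finite_range _).bddAbove i)
          (pow_nonneg τ.2 k)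
      exact (pi_norm_le_iff_of_nonneg ((abs_nonneg _).trans (hi ⟨0, hn⟩))).2 hi
    refine ⟨hilbertDist_ne_top hn (hseq 0) (hseq 1), hrate, fun k => ⟨?_, ?_⟩, ?_⟩
    · rw [← hnorm, hval]
      have hsup : 0 ≤ supNormRatio β :=
        Real.iSup_nonneg fun x => div_nonneg (apply_nonneg β _) (norm_nonneg _)
      have h1 : α (A *ᵥ xp) ≤
          α (A *ᵥ powerSeq α β A x₀ k) + α (A *ᵥ (powerSeq α β A x₀ k - xp)) := by
        rw [Matrix.mulVec_sub, map_sub_rev]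
        refine le_trans (le_of_eq ?_) (map_add_le_add α _ _)
        rw [add_sub_cancel]
      have h2 : β (powerSeq α β A x₀ k - xp) ≤
          supNormRatio β * ((τ : ℝ) ^ k * rateConst α β A τ x₀) :=
        (le_supNormRatio_mul_norm β _).trans (mul_le_mul_of_nonneg_left (hrate k) hsup)
      have h3 := (hmax (powerSeq α β A x₀ k - xp)).trans
        (mul_le_mul_of_nonneg_left h2 (apply_nonneg α _))
      linarith
    · rw [← hnorm, hval]
      simpa [hseq1 k] using hmax (powerSeq α β A x₀ k)
    · rw [tendsto_iff_norm_sub_tendsto_zero]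
      refine squeeze_zero (fun _ => norm_nonneg _) hrate ?_
      simpa using (tendsto_pow_atTop_nhds_zero_of_lt_one τ.2 hτ').mul_const (rateConst α β A τ x₀)
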